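/- **Definitions.** All C*-algebras are unital and nonzero; $\mathfrak{sa}(\mathfrak A)$ is the self-adjoint part of $\mathfrak A$ and $\mathscr S(\mathfrak A)$ its state space. A seminorm $\mathsf L$ defined on a subspace of $\mathfrak{sa}(\mathfrak A)$ is extended by $\infty$ outside of its domain $\mathrm{dom}(\mathsf L)$. A *Leibniz quantum compact metric space* $(\mathfrak A,\mathsf L)$ is a unital C*-algebra $\mathfrak A$ with a seminorm $\mathsf L$ on a norm-dense subspace $\mathrm{dom}(\mathsf L)$ of $\mathfrak{sa}(\mathfrak A)$ such that $\{a : \mathsf L(a)=0\}=\mathbb R 1_{\mathfrak A}$; the Monge-Kantorovich metric $$\mathsf{mk}_{\mathsf L}(\varphi,\psi)=\sup\{|\varphi(a)-\psi(a)| : a\in\mathfrak{sa}(\mathfrak A),\ \mathsf L(a)\le 1\}$$ is finite and metrizes the weak* topology of $\mathscr S(\mathfrak A)$; $\mathsf L$ is lower semicontinuous for the norm; and for all $a,b\in\mathrm{dom}(\mathsf L)$ the elements $\frac{ab+ba}{2}$ and $\frac{ab-ba}{2i}$ belong to $\mathrm{dom}(\mathsf L)$, with $$\max\left\{\mathsf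 L\left(\tfrac{ab+ba}{2}\right),\mathsf L\left(\tfrac{ab-ba}{2i}\right)\right\}\le \|a\|\,\mathsf L(b)+\|b\|\,\mathsf L(a).$$ A *tunnel* $\tau=(\mathfrak D,\mathsf L_{\mathfrak D},\pi_1,\pi_2)$ from $(\mathfrak A_1,\mathsf L_1)$ to $(\mathfrak A_2,\mathsf L_2)$ consists of a Leibniz quantum compact metric space $(\mathfrak D,\mathsf L_{\mathfrak D})$ and surjective unital *-morphisms $\pi_j:\mathfrak D\to\mathfrak A_j$ such that $\mathsf L_j(a)=\inf\{\mathsf L_{\mathfrak D}(d): d\in\mathfrak{sa}(\mathfrak D),\ \pi_j(d)=a\}$ for all $a\in\mathfrak{sa}(\mathfrak A_j)$, $j=1,2$. Put $S_j=\{\varphi\circ\pi_j:\varphi\in\mathscr S(\mathfrak A_j)\}\subseteq\mathscr S(\mathfrak D)$ and let $\mathrm{Haus}$ be the Hausdorff distance between subsets of $\mathscr S(\mathfrak D)$ for $\mathsf{mk}_{\mathsf L_{\mathfrak D}}$. The *length* $\lambda(\tau)$ of $\tau$ is the maximum of its *reach* $\mathrm{Haus}(S_1,S_2)$ and its *depth*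 $\mathrm{Haus}(\mathscr S(\mathfrak D),\overline{\mathrm{co}}(S_1\cup S_2))$, where $\overline{\mathrm{co}}$ is the weak*-closed convex hull. A *journey* from $(\mathfrak A,\mathsf L_{\mathfrak A})$ to $(\mathfrak B,\mathsf L_{\mathfrak B})$ is a finite sequence of Leibniz quantum compact metric spaces starting at $(\mathfrak A,\mathsf L_{\mathfrak A})$ and ending at $(\mathfrak B,\mathsf L_{\mathfrak B})$, together with a tunnel from each term to the next; its length is the sum of the lengths of its tunnels. The *dual Gromov-Hausdorff propinquity* $\mathsf\Lambda^\ast((\mathfrak A,\mathsf L_{\mathfrak A}),(\mathfrak B,\mathsf L_{\mathfrak B}))$ is the infimum of the lengths of all journeys from $(\mathfrak A,\mathsf L_{\mathfrak A})$ to $(\mathfrak B,\mathsf L_{\mathfrak B})$. **Corollary.** Let $(X,\mathsf d_X)$ and $(Y,\mathsf d_Y)$ be two nonempty compact metric spaces, let $C(X)$ and $C(Y)$ be the C*-algebras of complex-valued continuous functions on them, and let $\mathsf L_X$ be the Lipschitz seminorm $$\mathsf L_X(f)=\sup\left\{\frac{|f(x)-f(y)|}{\mathsf d_X(x,y)} :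 x,y\in X,\ x\ne y\right\}$$ on the real-valued $f\in C(X)$, and similarly $\mathsf L_Y$. Then $(C(X),\mathsf L_X)$ and $(C(Y),\mathsf L_Y)$ are Leibniz quantum compact metric spaces, and $$\mathsf\Lambda^\ast\big((C(X),\mathsf L_X),(C(Y),\mathsf L_Y)\big)\le \mathsf{GH}\big((X,\mathsf d_X),(Y,\mathsf d_Y)\big),$$ where $\mathsf{GH}$ is the Gromov-Hausdorff distance, i.e. the infimum of the Hausdorff distances between $f(X)$ and $g(Y)$ over all isometric embeddings $f,g$ of $X$ and $Y$ into a common metric space. -/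

import Mathlib

open scoped ENNReal CStarAlgebra ComplexOrder

universe u

noncomputable section

namespace DualPropinquity

section Basic

variable {A : Type u} [CStarAlgebra A]

/-- The state space of a unital C*-algebra: the positive linear functionals taking the value `1`
at the unit, as a subset of the dual space. The type `stateSpace A` carries the topology induced
by `WeakDual ℂ A`, which is the weak* topology. -/
def stateSpace (A : Type u) [CStarAlgebra A] : Set (WeakDual ℂ A) :=
  {φ | φ 1 = 1 ∧ ∀ a : A, 0 ≤ φ (star a * a)}

/-- The Jordan product `(ab + ba) / 2` on the self-adjoint part. -/
def jordan (a b : selfAdjoint A) : selfAdjoint A :=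
  ⟨(1 / 2 : ℂ) • ((a : A) * b + b * a), by
    have ha : star (a : A) = a := a.2
    have hb : star (b : A) = b := b.2
    rw [selfAdjoint.mem_iff, star_smul, star_add, star_mul, star_mul, ha, hb, add_comm]
    congr 1
    simp⟩

/-- The Lie product `(ab - ba) / (2i)` on the self-adjoint part. -/
def lie (a b : selfAdjoint A) : selfAdjoint A :=
  ⟨(1 / (2 * Complex.I) : ℂ) • ((a : A) * b - b * a), by
    have ha : star (a : A) = a := a.2
    have hb : star (b : A) = b := b.2
    rw [selfAdjoint.mem_iff, star_smul, star_sub, star_mul, star_mul, ha, hb,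
      ← neg_sub ((a : A) * b), smul_neg, ← neg_smul]
    congr 1
    simp⟩

/-- `(A, L)` is a Lipschitz pair. A seminorm on a subspace `dom L` of the self-adjoint part is
represented by its extension by `∞` outside of its domain, so that `dom L = {a | L a < ∞}`. -/
structure IsLipschitzPair (L : selfAdjoint A → ℝ≥0∞) : Prop where
  add_le : ∀ a b, L (a + b) ≤ L a + L b
  smul_eq : ∀ (r : ℝ) (a), L (r • a) = ‖r‖ₑ * L a
  dense_dom : Dense {a | L a < ∞}
  eq_zero_iff : ∀ a, L a = 0 ↔ ∃ r : ℝ, a = r • (1 : selfAdjoint A)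

/-- The Monge-Kantorovich metric on the state space. -/
def kantorovich (L : selfAdjoint A → ℝ≥0∞) (φ ψ : stateSpace A) : ℝ≥0∞ :=
  ⨆ (a : selfAdjoint A) (_ : L a ≤ 1), ‖(φ : WeakDual ℂ A) (a : A) - (ψ : WeakDual ℂ A) (a : A)‖ₑ

/-- `(A, L)` is a quantum compact metric space: a Lipschitz pair whose Monge-Kantorovich metric is
finite and has the weak* topology of the state space as its metric topology. -/
structure IsQuantumCompactMetricSpace (L : selfAdjoint A → ℝ≥0∞) : Prop extends
    IsLipschitzPair L where
  kantorovich_lt_top : ∀ φ ψ : stateSpace A, kantorovich L φ ψ < ∞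
  isOpen_iff : ∀ U : Set (stateSpace A), IsOpen U ↔
    ∀ φ ∈ U, ∃ ε : ℝ≥0∞, 0 < ε ∧ ∀ ψ, kantorovich L φ ψ < ε → ψ ∈ U

/-- The Leibniz inequalities. The right-hand sides being finite on `dom L`, they
contain the fact that `dom L` is closed under the Jordan and the Lie products. -/
structure IsLeibniz (L : selfAdjoint A → ℝ≥0∞) : Prop where
  jordan_le : ∀ a b, L a < ∞ → L b < ∞ →
    L (jordan a b) ≤ ‖(a : A)‖ₑ * L b + ‖(b : A)‖ₑ * L a
  lie_le : ∀ a b, L a < ∞ → L b < ∞ →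
    L (lie a b) ≤ ‖(a : A)‖ₑ * L b + ‖(b : A)‖ₑ * L a

/-- `(A, L)` is a Leibniz quantum compact metric space. -/
structure IsLeibnizQCMS (L : selfAdjoint A → ℝ≥0∞) : Prop extends
    IsQuantumCompactMetricSpace L, IsLeibniz L where
  lowerSemicontinuous : LowerSemicontinuous L

/-- The state space with the extended (pseudo-)distance `kantorovich L`, so that Mathlib's
Hausdorff distance can be used. -/
@[reducible]
def kantorovichEMetric (L : selfAdjoint A → ℝ≥0∞) : PseudoEMetricSpace (stateSpace A) where
  edist := kantorovich L
  edist_self φ := by simp [kantorovich]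
  edist_comm φ ψ := by
    simp only [kantorovich]
    refine iSup_congr fun a => iSup_congr fun _ => ?_
    rw [← enorm_neg, neg_sub]
  edist_triangle φ ψ χ := by
    refine iSup₂_le fun a ha => ?_
    have h : ‖(φ : WeakDual ℂ A) (a : A) - (χ : WeakDual ℂ A) (a : A)‖ₑ ≤
        ‖(φ : WeakDual ℂ A) (a : A) - (ψ : WeakDual ℂ A) (a : A)‖ₑ +
        ‖(ψ : WeakDual ℂ A) (a : A) - (χ : WeakDual ℂ A) (a : A)‖ₑ := by
      rw [← sub_add_sub_cancel ((φ : WeakDual ℂ A) (a : A)) ((ψ : WeakDual ℂ A) (a : A))]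
      exact enorm_add_le _ _
    refine h.trans (add_le_add ?_ ?_)
    · exact le_iSup₂ (f := fun (a : selfAdjoint A) (_ : L a ≤ 1) =>
        ‖(φ : WeakDual ℂ A) (a : A) - (ψ : WeakDual ℂ A) (a : A)‖ₑ) a ha
    · exact le_iSup₂ (f := fun (a : selfAdjoint A) (_ : L a ≤ 1) =>
        ‖(ψ : WeakDual ℂ A) (a : A) - (χ : WeakDual ℂ A) (a : A)‖ₑ) a ha

/-- The Hausdorff distance between sets of states for the Monge-Kantorovich metric. -/
def kantorovichHausdorff (L : selfAdjoint A → ℝ≥0∞) (S T : Set (stateSpace A)) : ℝ≥0∞ :=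
  @Metric.hausdorffEDist (stateSpace A) (kantorovichEMetric L) S T

/-- The dual map `φ ↦ φ ∘ π` from the states of `A` to the states of `D`. -/
def dualMap {D : Type u} [CStarAlgebra D] (π : D →⋆ₐ[ℂ] A) (φ : stateSpace A) : stateSpace D :=
  ⟨StrongDual.toWeakDual
      ((WeakDual.toStrongDual (φ : WeakDual ℂ A)).comp
        ⟨π.toAlgHom.toLinearMap, map_continuous π⟩), by
    refine ⟨?_, fun d => ?_⟩
    · change (φ : WeakDual ℂ A) (π 1) = 1
      rw [map_one]
      exact φ.2.1
    · change 0 ≤ (φ : WeakDual ℂ A) (π (star d * d))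
      rw [map_mul, map_star]
      exact φ.2.2 (π d)⟩

end Basic

/-- The class of all Leibniz quantum compact metric spaces (over nonzero unital C*-algebras). -/
structure LeibnizQCMS : Type (u + 1) where
  carrier : Type u
  [cstarAlgebra : CStarAlgebra carrier]
  [nontrivial : Nontrivial carrier]
  lipNorm : selfAdjoint carrier → ℝ≥0∞
  isLeibnizQCMS : IsLeibnizQCMS lipNorm

attribute [instance] LeibnizQCMS.cstarAlgebra LeibnizQCMS.nontrivial

/-- A tunnel `(D, L_D, π₁, π₂)` from `A` to `B`. -/
structure Tunnel (A B : LeibnizQCMS.{u}) : Type (u + 1) where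
  mid : LeibnizQCMS.{u}
  left : mid.carrier →⋆ₐ[ℂ] A.carrier
  right : mid.carrier →⋆ₐ[ℂ] B.carrier
  left_surjective : Function.Surjective left
  right_surjective : Function.Surjective right
  left_quotient : ∀ a : selfAdjoint A.carrier, A.lipNorm a =
    ⨅ (d : selfAdjoint mid.carrier) (_ : left (d : mid.carrier) = (a : A.carrier)), mid.lipNorm d
  right_quotient : ∀ b : selfAdjoint B.carrier, B.lipNorm b =
    ⨅ (d : selfAdjoint mid.carrier) (_ : right (d : mid.carrier) = (b : B.carrier)), mid.lipNorm d

namespace Tunnel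

variable {A B : LeibnizQCMS.{u}} (τ : Tunnel A B)

/-- The reach of a tunnel. -/
def reach : ℝ≥0∞ :=
  kantorovichHausdorff τ.mid.lipNorm (Set.range (dualMap τ.left)) (Set.range (dualMap τ.right))

/-- The states of `D` in the weak*-closed convex hull of the states coming from `A` and `B`. -/
def hullStates : Set (stateSpace τ.mid.carrier) :=
  {φ | (φ : WeakDual ℂ τ.mid.carrier) ∈ closedConvexHull ℝ
    (Subtype.val '' (Set.range (dualMap τ.left) ∪ Set.range (dualMap τ.right)))}

/-- The depth of a tunnel. -/
def depth : ℝ≥0∞ :=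
  kantorovichHausdorff τ.mid.lipNorm Set.univ τ.hullStates

/-- The length of a tunnel. -/
def length : ℝ≥0∞ := max τ.reach τ.depth

end Tunnel

/-- A journey from `A` to `B`, of size `n`. -/
structure Journey (A B : LeibnizQCMS.{u}) : Type (u + 1) where
  n : ℕ
  space : Fin (n + 1) → LeibnizQCMS.{u}
  space_zero : space 0 = A
  space_last : space (Fin.last n) = B
  tunnel : ∀ j : Fin n, Tunnel (space j.castSucc) (space j.succ)

/-- The length of a journey. -/
def Journey.length {A B : LeibnizQCMS.{u}} (Υ : Journey A B) : ℝ≥0∞ :=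
  ∑ j, (Υ.tunnel j).length

/-- The dual Gromov-Hausdorff propinquity. -/
def dualPropinquity (A B : LeibnizQCMS.{u}) : ℝ≥0∞ :=
  ⨅ Υ : Journey A B, Υ.length

/-- The Lipschitz seminorm on the self-adjoint (i.e. real-valued) elements of `C(X)`. -/
def lipSeminorm (X : Type u) [MetricSpace X] [CompactSpace X] (f : selfAdjoint C(X, ℂ)) : ℝ≥0∞ :=
  ⨆ (x : X) (y : X) (_ : x ≠ y), ‖(f : C(X, ℂ)) x - (f : C(X, ℂ)) y‖ₑ / edist x y

end DualPropinquity

end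

/-! An optimal Gromov-Hausdorff coupling `Z` of `X` and `Y` is compact and is covered by the two
isometric copies. Restriction of functions gives surjections from `C(Z)` onto `C(X)` and `C(Y)`, and
McShane's theorem makes both Lipschitz seminorms quotients of that of `Z`: this is a tunnel, whose
depth is 0 and whose reach is at most the Hausdorff distance of the copies.

Both estimates avoid measure theory. With a partition of unity `p` of small mesh, `f` is uniformly
close to `∑ i, f (x i) • p i`, so a state `φ` is close to the convex combination of evaluations at
the `x i` with weights `φ (p i)`, uniformly over 1-Lipschitz `f` (`state_norm_map_sub_sum_le`,
`exists_combState_kantorovich_le`). For the reach, each `x i` is moved to a nearby point of the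
other copy. For the depth, every evaluation on `Z` comes from one of the copies. The same
approximation shows that the Monge-Kantorovich metric is weak* continuous. -/

noncomputable section

namespace DualPropinquity

open Filter Topology

/-! ### The Lipschitz seminorm: Leibniz rule, lower semicontinuity, dense domain. -/

section Compact

variable {K : Type u} [MetricSpace K]

/-- A real-valued continuous function as a self-adjoint element of `C(K, ℂ)`. -/
def ofRealMap (g : C(K, ℝ)) : selfAdjoint C(K, ℂ) :=
  ⟨⟨fun x => (g x : ℂ), by fun_prop⟩, by ext x; simp⟩

@[simp]
theorem ofRealMap_apply (g : C(K, ℝ)) (x : K) : (ofRealMap g : C(K, ℂ)) x = g x := rfl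

theorem ofRealMap_surjective : Function.Surjective (ofRealMap (K := K)) := by
  intro f
  refine ⟨⟨fun x => ((f : C(K, ℂ)) x).re, by fun_prop⟩, Subtype.ext (ContinuousMap.ext fun x => ?_)⟩
  have h : star ((f : C(K, ℂ)) x) = (f : C(K, ℂ)) x := congr($(f.2.star_eq) x)
  exact Complex.conj_eq_iff_re.1 h

theorem continuous_ofRealMap : Continuous (ofRealMap (K := K)) := by
  refine Continuous.subtype_mk ?_ _
  exact ContinuousMap.continuous_postcomp (⟨Complex.ofReal, Complex.continuous_ofReal⟩ : C(ℝ, ℂ))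

variable [CompactSpace K]

theorem lipSeminorm_le_iff (f : selfAdjoint C(K, ℂ)) (c : ℝ≥0∞) :
    lipSeminorm K f ≤ c ↔ ∀ x y, edist ((f : C(K, ℂ)) x) ((f : C(K, ℂ)) y) ≤ c * edist x y := by
  simp only [lipSeminorm, iSup_le_iff]
  refine forall₂_congr fun x y => ⟨fun h => ?_, fun h hxy => ?_⟩
  · by_cases hxy : x = y
    · simp [hxy]
    · have := h hxy
      rwa [ENNReal.div_le_iff (by simpa using hxy) (edist_ne_top x y), ← edist_eq_enorm_sub] at this
  · rwa [ENNReal.div_le_iff (by simpa using hxy) (edist_ne_top x y), ← edist_eq_enorm_sub]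

theorem edist_le_lipSeminorm_mul (f : selfAdjoint C(K, ℂ)) (x y : K) :
    edist ((f : C(K, ℂ)) x) ((f : C(K, ℂ)) y) ≤ lipSeminorm K f * edist x y :=
  (lipSeminorm_le_iff f _).1 le_rfl x y

theorem dist_le_of_lipSeminorm_le_one {f : selfAdjoint C(K, ℂ)} (hf : lipSeminorm K f ≤ 1)
    (x y : K) : ‖(f : C(K, ℂ)) x - (f : C(K, ℂ)) y‖ ≤ dist x y := by
  have := (lipSeminorm_le_iff f _).1 hf x y
  rw [one_mul, edist_dist, edist_dist, ENNReal.ofReal_le_ofReal_iff dist_nonneg] at this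
  rwa [← dist_eq_norm]

theorem enorm_apply_le (f : C(K, ℂ)) (x : K) : ‖f x‖ₑ ≤ ‖f‖ₑ := by
  rw [enorm_le_iff_norm_le]
  exact f.norm_coe_le_norm x

theorem lipSeminorm_add_le (f g : selfAdjoint C(K, ℂ)) :
    lipSeminorm K (f + g) ≤ lipSeminorm K f + lipSeminorm K g := by
  refine (lipSeminorm_le_iff _ _).2 fun x y => ?_
  rw [add_mul]
  exact (edist_add_add_le _ _ _ _).trans
    (add_le_add (edist_le_lipSeminorm_mul f x y) (edist_le_lipSeminorm_mul g x y))

theorem lipSeminorm_smul (r : ℝ) (f : selfAdjoint C(K, ℂ)) :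
    lipSeminorm K (r • f) = ‖r‖ₑ * lipSeminorm K f := by
  simp only [lipSeminorm, ENNReal.mul_iSup]
  refine iSup_congr fun x => iSup_congr fun y => iSup_congr fun _ => ?_
  have : ((r • f : selfAdjoint C(K, ℂ)) : C(K, ℂ)) x - ((r • f : selfAdjoint C(K, ℂ)) : C(K, ℂ)) y
      = r • ((f : C(K, ℂ)) x - (f : C(K, ℂ)) y) := by simp [mul_sub]
  rw [this, enorm_smul, mul_div_assoc]

theorem lipSeminorm_jordan_le (f g : selfAdjoint C(K, ℂ)) :
    lipSeminorm K (jordan f g) ≤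
      ‖(f : C(K, ℂ))‖ₑ * lipSeminorm K g + ‖(g : C(K, ℂ))‖ₑ * lipSeminorm K f := by
  refine (lipSeminorm_le_iff _ _).2 fun x y => ?_
  have h : ∀ z, (jordan f g : C(K, ℂ)) z = (f : C(K, ℂ)) z * (g : C(K, ℂ)) z := fun z => by
    change (1 / 2 : ℂ) * ((f : C(K, ℂ)) z * (g : C(K, ℂ)) z + (g : C(K, ℂ)) z * (f : C(K, ℂ)) z) = _
    ring
  rw [h, h, edist_eq_enorm_sub, add_mul, mul_assoc, mul_assoc,
    show ∀ a b c d : ℂ, a * b - c * d = a * (b - d) + d * (a - c) from fun a b c d => by ring]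
  refine (enorm_add_le _ _).trans (add_le_add ?_ ?_) <;> rw [enorm_mul, ← edist_eq_enorm_sub]
  · exact mul_le_mul' (enorm_apply_le _ _) (edist_le_lipSeminorm_mul g x y)
  · exact mul_le_mul' (enorm_apply_le _ _) (edist_le_lipSeminorm_mul f x y)

theorem lipSeminorm_lie (f g : selfAdjoint C(K, ℂ)) : lipSeminorm K (lie f g) = 0 := by
  have h : ∀ z, (lie f g : C(K, ℂ)) z = 0 := fun z => by
    change (1 / (2 * Complex.I) : ℂ) *
      ((f : C(K, ℂ)) z * (g : C(K, ℂ)) z - (g : C(K, ℂ)) z * (f : C(K, ℂ)) z) = _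
    ring
  refine le_antisymm ((lipSeminorm_le_iff _ _).2 fun x y => ?_) zero_le
  simp [h]

theorem lipSeminorm_const (r : ℝ) : lipSeminorm K (r • (1 : selfAdjoint C(K, ℂ))) = 0 := by
  refine le_antisymm ((lipSeminorm_le_iff _ _).2 fun x y => ?_) zero_le
  simp

theorem lipSeminorm_eq_zero_iff [Nonempty K] (f : selfAdjoint C(K, ℂ)) :
    lipSeminorm K f = 0 ↔ ∃ r : ℝ, f = r • (1 : selfAdjoint C(K, ℂ)) := by
  refine ⟨fun h => ?_, fun ⟨r, hr⟩ => hr ▸ lipSeminorm_const r⟩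
  obtain ⟨g, rfl⟩ := ofRealMap_surjective f
  obtain ⟨x₀⟩ := ‹Nonempty K›
  refine ⟨g x₀, Subtype.ext (ContinuousMap.ext fun x => ?_)⟩
  have := (lipSeminorm_le_iff _ _).1 h.le x x₀
  simp only [zero_mul, nonpos_iff_eq_zero, edist_eq_zero] at this
  rw [this]
  simp

theorem lowerSemicontinuous_lipSeminorm : LowerSemicontinuous (lipSeminorm K) := by
  refine lowerSemicontinuous_iSup fun x => lowerSemicontinuous_iSup fun y =>
    lowerSemicontinuous_iSup fun hxy => Continuous.lowerSemicontinuous ?_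
  refine (ENNReal.continuous_div_const _ (by simpa using hxy)).comp (continuous_enorm.comp ?_)
  exact ((ContinuousEvalConst.continuous_eval_const x).comp continuous_subtype_val).sub
    ((ContinuousEvalConst.continuous_eval_const y).comp continuous_subtype_val)

/-- The real-valued Lipschitz functions on a compact metric space. -/
def lipschitzSubalgebra (K : Type u) [MetricSpace K] [CompactSpace K] : Subalgebra ℝ C(K, ℝ) where
  carrier := {g | lipSeminorm K (ofRealMap g) < ∞}
  add_mem' {f g} hf hg := by
    have h : ofRealMap (f + g) = ofRealMap f + ofRealMap g := by ext x; simp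
    simp only [Set.mem_ofPred_eq, h]
    exact (lipSeminorm_add_le _ _).trans_lt (ENNReal.add_lt_top.2 ⟨hf, hg⟩)
  mul_mem' {f g} hf hg := by
    have h : ofRealMap (f * g) = jordan (ofRealMap f) (ofRealMap g) := by
      ext x
      change ((f x * g x : ℝ) : ℂ) = (1 / 2 : ℂ) * ((f x : ℂ) * g x + g x * f x)
      push_cast
      ring
    simp only [Set.mem_ofPred_eq, h]
    exact (lipSeminorm_jordan_le _ _).trans_lt (ENNReal.add_lt_top.2
      ⟨ENNReal.mul_lt_top enorm_lt_top hg, ENNReal.mul_lt_top enorm_lt_top hf⟩)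
  algebraMap_mem' r := by
    have h : ofRealMap (algebraMap ℝ C(K, ℝ) r) = r • 1 := by ext x; simp
    simp [h, lipSeminorm_const]

/-- Stone-Weierstrass: the 1-Lipschitz functions `dist · y` separate points. -/
theorem dense_lipSeminorm_lt_top : Dense {f | lipSeminorm K f < ∞} := by
  have hsep : (lipschitzSubalgebra K).SeparatesPoints := fun x y hxy => by
    refine ⟨fun z => dist z y, ⟨⟨fun z => dist z y, by fun_prop⟩, ?_, rfl⟩, by simpa using hxy⟩
    refine lt_of_le_of_lt ((lipSeminorm_le_iff _ 1).2 fun a b => ?_) ENNReal.one_lt_top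
    rw [one_mul, edist_dist, edist_dist]
    refine ENNReal.ofReal_le_ofReal ?_
    simpa [Complex.dist_eq, ← Complex.ofReal_sub] using abs_dist_sub_le a b y
  have hd : Dense (lipschitzSubalgebra K : Set C(K, ℝ)) := fun f => by
    have := ContinuousMap.subalgebra_topologicalClosure_eq_top_of_separatesPoints _ hsep
    exact this.ge (Algebra.mem_top (x := f))
  refine (ofRealMap_surjective.denseRange.dense_image continuous_ofRealMap hd).mono ?_
  rintro _ ⟨g, hg, rfl⟩
  exact hg

end Compact

/-! ### States of `C(K)` and their approximation by convex combinations of evaluations. -/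

section States

variable {K : Type u} [MetricSpace K] [CompactSpace K]

theorem state_map_one {A : Type u} [CStarAlgebra A] (φ : stateSpace A) :
    (φ : WeakDual ℂ A) 1 = 1 := φ.2.1

theorem state_map_ofRealMap_nonneg (φ : stateSpace C(K, ℂ)) {g : C(K, ℝ)}
    (hg : ∀ x, 0 ≤ g x) : 0 ≤ (φ : WeakDual ℂ C(K, ℂ)) (ofRealMap g : C(K, ℂ)) := by
  have h : (ofRealMap g : C(K, ℂ)) =
      star (ofRealMap ⟨fun x => √(g x), by fun_prop⟩ : C(K, ℂ)) *
        (ofRealMap ⟨fun x => √(g x), by fun_prop⟩ : C(K, ℂ)) := by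
    ext x
    simp [← Complex.ofReal_mul, Real.mul_self_sqrt (hg x)]
  rw [h]
  exact φ.2.2 _

/-- Positivity on `c - f` and `c + f` suffices; this also forces the value at `f` to be real. -/
theorem state_norm_map_le (φ : stateSpace C(K, ℂ)) (f : selfAdjoint C(K, ℂ)) {c : ℝ}
    (hf : ∀ x, ‖(f : C(K, ℂ)) x‖ ≤ c) : ‖(φ : WeakDual ℂ C(K, ℂ)) (f : C(K, ℂ))‖ ≤ c := by
  obtain ⟨g, rfl⟩ := ofRealMap_surjective f
  have hg : ∀ x, |g x| ≤ c := fun x => by simpa using hf x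
  have h₁ := state_map_ofRealMap_nonneg φ (g := ContinuousMap.const K c - g)
    fun x => by simpa using (abs_le.1 (hg x)).2
  have h₂ := state_map_ofRealMap_nonneg φ (g := ContinuousMap.const K c + g)
    fun x => by simpa [← neg_le_iff_add_nonneg'] using (abs_le.1 (hg x)).1
  have e₁ : (ofRealMap (ContinuousMap.const K c - g) : C(K, ℂ)) = (c : ℂ) • 1 - ofRealMap g := by
    ext x; simp
  have e₂ : (ofRealMap (ContinuousMap.const K c + g) : C(K, ℂ)) = (c : ℂ) • 1 + ofRealMap g := by
    ext x; simp
  rw [e₁, map_sub, map_smul, state_map_one φ, Complex.nonneg_iff] at h₁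
  rw [e₂, map_add, map_smul, state_map_one φ, Complex.nonneg_iff] at h₂
  simp only [smul_eq_mul, mul_one, Complex.sub_re, Complex.ofReal_re, Complex.sub_im,
    Complex.ofReal_im, Complex.add_re, Complex.add_im] at h₁ h₂
  set z := (φ : WeakDual ℂ C(K, ℂ)) (ofRealMap g : C(K, ℂ))
  have hz : z = (z.re : ℂ) := Complex.ext rfl (by simpa using h₂.2.symm)
  rw [hz, Complex.norm_real, Real.norm_eq_abs, abs_le]
  constructor <;> linarith

/-- Partitions of unity subordinate to a cover by finitely many balls of a given radius. -/
theorem exists_finite_partition (K : Type u) [MetricSpace K] [CompactSpace K] {ε : ℝ}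
    (hε : 0 < ε) : ∃ (t : Finset K) (p : t → C(K, ℝ)), (∀ i x, 0 ≤ p i x) ∧
      (∀ x, ∑ i, p i x = 1) ∧ ∀ i x, p i x ≠ 0 → dist x i < ε := by
  obtain ⟨t, -, ht⟩ := finite_cover_balls_of_compact (isCompact_univ (X := K)) hε
  obtain ⟨htf, ht⟩ := ht
  lift t to Finset K using htf
  obtain ⟨p, hp⟩ := PartitionOfUnity.exists_isSubordinate isClosed_univ
    (fun i : t => Metric.ball (i : K) ε) (fun i => Metric.isOpen_ball) (by
      simpa [Set.iUnion_subtype] using ht)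
  refine ⟨t, p, p.nonneg, fun x => ?_, fun i x hx => ?_⟩
  · rw [← finsum_eq_sum_of_fintype]
    exact p.sum_eq_one (Set.mem_univ x)
  · exact hp i (subset_tsupport _ hx)

/-- At each `x`, `f - ∑ i, c i • p i` is the average of the `f x - c i` with weights `p i x`. Only
indices with `p i x ≠ 0` contribute, so its sup norm is at most `r`, and states do not increase the
norm of self-adjoint elements. -/
theorem state_norm_map_sub_sum_le {ι : Type*} [Fintype ι] (φ : stateSpace C(K, ℂ))
    {p : ι → C(K, ℝ)} (hp : ∀ i x, 0 ≤ p i x) (hp₁ : ∀ x, ∑ i, p i x = 1)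
    (f : selfAdjoint C(K, ℂ)) {c : ι → ℝ} {r : ℝ}
    (h : ∀ i x, p i x ≠ 0 → ‖(f : C(K, ℂ)) x - c i‖ ≤ r) :
    ‖(φ : WeakDual ℂ C(K, ℂ)) (f : C(K, ℂ)) -
      ∑ i, (φ : WeakDual ℂ C(K, ℂ)) (ofRealMap (p i) : C(K, ℂ)) * c i‖ ≤ r := by
  have e : (φ : WeakDual ℂ C(K, ℂ)) (f : C(K, ℂ)) -
      ∑ i, (φ : WeakDual ℂ C(K, ℂ)) (ofRealMap (p i) : C(K, ℂ)) * c i =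
      (φ : WeakDual ℂ C(K, ℂ)) ((f - ofRealMap (∑ i, c i • p i) : selfAdjoint C(K, ℂ)) : C(K, ℂ)) := by
    have : (ofRealMap (∑ i, c i • p i) : C(K, ℂ)) = ∑ i, (c i : ℂ) • (ofRealMap (p i) : C(K, ℂ)) := by
      ext x
      simp
    rw [AddSubgroupClass.coe_sub, map_sub, this, map_sum]
    simp only [map_smul, smul_eq_mul, mul_comm]
  rw [e]
  refine state_norm_map_le φ _ fun x => ?_
  have hx : ∑ i, (p i x : ℂ) = 1 := by exact_mod_cast hp₁ x
  have : ((f - ofRealMap (∑ i, c i • p i) : selfAdjoint C(K, ℂ)) : C(K, ℂ)) x =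
      ∑ i, (p i x : ℂ) * ((f : C(K, ℂ)) x - c i) := by
    simp only [mul_sub, Finset.sum_sub_distrib, ← Finset.sum_mul, hx, one_mul]
    simp [mul_comm]
  rw [this, ← mul_one r, ← hp₁ x, Finset.mul_sum]
  refine norm_sum_le_of_le _ fun i _ => ?_
  rw [norm_mul, Complex.norm_real, Real.norm_of_nonneg (hp i x), mul_comm]
  by_cases hi : p i x = 0
  · simp [hi]
  · exact mul_le_mul_of_nonneg_right (h i x hi) (hp i x)

theorem sum_map_partition {ι : Type*} [Fintype ι] (φ : stateSpace C(K, ℂ))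
    {p : ι → C(K, ℝ)} (hp₁ : ∀ x, ∑ i, p i x = 1) :
    ∑ i, (φ : WeakDual ℂ C(K, ℂ)) (ofRealMap (p i) : C(K, ℂ)) = 1 := by
  rw [← map_sum, ← state_map_one φ]
  congr 1
  ext x
  simpa using congr((($(hp₁ x) : ℝ) : ℂ))

theorem sum_smul_eval_apply {ι : Type*} [Fintype ι] (w : ι → ℝ) (z : ι → K) (f : C(K, ℂ)) :
    (∑ i, w i • StrongDual.toWeakDual (ContinuousMap.evalCLM ℂ (z i)) : WeakDual ℂ C(K, ℂ)) f =
      ∑ i, (w i : ℂ) * f (z i) := by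
  rw [← WeakDual.toStrongDual_apply, map_sum, _root_.sum_apply]
  rfl

/-- A finite convex combination of evaluations, as a state of `C(K, ℂ)`. -/
def combState {ι : Type*} [Fintype ι] (w : ι → ℝ) (hw : ∀ i, 0 ≤ w i) (hw₁ : ∑ i, w i = 1)
    (z : ι → K) : stateSpace C(K, ℂ) :=
  ⟨∑ i, w i • StrongDual.toWeakDual (ContinuousMap.evalCLM ℂ (z i)), by
    have h := sum_smul_eval_apply w z
    refine ⟨?_, fun f => ?_⟩
    · rw [h]
      simpa using congr((($hw₁ : ℝ) : ℂ))
    · rw [h]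
      refine Finset.sum_nonneg fun i _ => mul_nonneg (by exact_mod_cast hw i) ?_
      exact star_mul_self_nonneg (f (z i))⟩

theorem combState_apply {ι : Type*} [Fintype ι] (w : ι → ℝ) (hw : ∀ i, 0 ≤ w i)
    (hw₁ : ∑ i, w i = 1) (z : ι → K) (f : C(K, ℂ)) :
    (combState w hw hw₁ z : WeakDual ℂ C(K, ℂ)) f = ∑ i, (w i : ℂ) * f (z i) :=
  sum_smul_eval_apply w z f

/-! ### The Monge-Kantorovich metric and the weak* topology. -/

theorem kantorovich_le_iff {A : Type u} [CStarAlgebra A] {L : selfAdjoint A → ℝ≥0∞}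
    {φ ψ : stateSpace A} {r : ℝ} (hr : 0 ≤ r) : kantorovich L φ ψ ≤ ENNReal.ofReal r ↔
      ∀ a : selfAdjoint A, L a ≤ 1 →
        ‖(φ : WeakDual ℂ A) (a : A) - (ψ : WeakDual ℂ A) (a : A)‖ ≤ r := by
  simp only [kantorovich, iSup_le_iff]
  refine forall₂_congr fun a _ => ?_
  rw [← ofReal_norm, ENNReal.ofReal_le_ofReal_iff hr]

/-- If `K` embeds isometrically in `Z` and every point of `K` is moved by less than `r` by
`y : K → Z`, then any state of `C(Z)` coming from `C(K)` is within `r + ε` of a finite convex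
combination of evaluations at points of the range of `y`. -/
theorem exists_combState_kantorovich_le {Z : Type u} [MetricSpace Z] [CompactSpace Z]
    (j : C(K, Z)) (hj : Isometry j) (y : K → Z) {r ε : ℝ} (hε : 0 < ε)
    (hr : ∀ k, dist (j k) (y k) ≤ r) (hr₀ : 0 ≤ r) (φ : stateSpace C(K, ℂ)) :
    ∃ (t : Finset K) (w : t → ℝ) (hw : ∀ i, 0 ≤ w i) (hw₁ : ∑ i, w i = 1),
      kantorovich (lipSeminorm Z) (dualMap (ContinuousMap.compStarAlgHom' ℂ ℂ j) φ)
        (combState w hw hw₁ fun i => y i) ≤ ENNReal.ofReal (r + ε) := by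
  obtain ⟨t, p, hp, hp₁, hpε⟩ := exists_finite_partition K hε
  have hnn : ∀ i, 0 ≤ (φ : WeakDual ℂ C(K, ℂ)) (ofRealMap (p i) : C(K, ℂ)) :=
    fun i => state_map_ofRealMap_nonneg φ (hp i)
  have hre : ∀ i, (((φ : WeakDual ℂ C(K, ℂ)) (ofRealMap (p i) : C(K, ℂ))).re : ℂ) =
      (φ : WeakDual ℂ C(K, ℂ)) (ofRealMap (p i) : C(K, ℂ)) := fun i =>
    (Complex.eq_re_of_ofReal_le (r := 0) (by simpa using hnn i)).symm
  refine ⟨t, fun i => ((φ : WeakDual ℂ C(K, ℂ)) (ofRealMap (p i) : C(K, ℂ))).re,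
    fun i => (Complex.nonneg_iff.1 (hnn i)).1, ?_, ?_⟩
  · rw [← Complex.re_sum, sum_map_partition φ hp₁, Complex.one_re]
  · refine (kantorovich_le_iff (by positivity)).2 fun f hf => ?_
    obtain ⟨g, rfl⟩ := ofRealMap_surjective f
    rw [combState_apply]
    simp only [hre]
    -- The constants are the values of `g` at the displaced points `y i`: where `p i x ≠ 0`, `j x`
    -- is within `ε` of `j i`, which is within `r` of `y i`.
    refine state_norm_map_sub_sum_le φ hp hp₁ (ofRealMap (g.comp j)) fun i x hx => ?_
    refine (dist_le_of_lipSeminorm_le_one hf (j x) (y i)).trans ?_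
    have h₁ := dist_triangle (j x) (j i) (y i)
    rw [hj.dist_eq] at h₁
    linarith [hpε i x hx, hr i]

/-- A fixed finite partition approximates all 1-Lipschitz functions at once, so closeness of states
on its finitely many members controls the whole supremum. The `δ / 3` are spent on approximating at
`φ`, comparing the sums, and approximating at `ψ`. -/
theorem eventually_kantorovich_lt (φ : stateSpace C(K, ℂ)) {ε : ℝ≥0∞} (hε : 0 < ε) :
    ∀ᶠ ψ in 𝓝 φ, kantorovich (lipSeminorm K) φ ψ < ε := by
  obtain ⟨δ, hδ, hδε⟩ := ENNReal.lt_iff_exists_nnreal_btwn.1 hε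
  have hδ₀ : (0 : ℝ) < δ := by exact_mod_cast hδ
  obtain ⟨t, p, hp, hp₁, hpε⟩ := exists_finite_partition K (ε := δ / 3) (by positivity)
  set D : ℝ := Metric.diam (Set.univ : Set K)
  have hD : ∀ x y : K, dist x y ≤ D := fun x y =>
    Metric.dist_le_diam_of_mem isCompact_univ.isBounded (Set.mem_univ x) (Set.mem_univ y)
  have hcont : Continuous fun ψ : stateSpace C(K, ℂ) =>
      ∑ i, ‖(φ : WeakDual ℂ C(K, ℂ)) (ofRealMap (p i) : C(K, ℂ)) -
        (ψ : WeakDual ℂ C(K, ℂ)) (ofRealMap (p i) : C(K, ℂ))‖ * D := by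
    refine continuous_finsetSum _ fun i _ => (Continuous.norm ?_).mul continuous_const
    exact continuous_const.sub ((WeakDual.eval_continuous _).comp continuous_subtype_val)
  have hev := hcont.continuousAt.eventually_lt (x₀ := φ) (continuousAt_const (y := (δ : ℝ) / 3))
    (by simpa using hδ₀)
  filter_upwards [hev] with ψ hψ
  refine lt_of_le_of_lt ?_ hδε
  rw [← ENNReal.ofReal_coe_nnreal]
  refine (kantorovich_le_iff hδ₀.le).2 fun f hf => ?_
  obtain ⟨g, rfl⟩ := ofRealMap_surjective f
  have hg := dist_le_of_lipSeminorm_le_one hf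
  have key : ∀ χ : stateSpace C(K, ℂ), ‖(χ : WeakDual ℂ C(K, ℂ)) (ofRealMap g : C(K, ℂ)) -
      ∑ i, (χ : WeakDual ℂ C(K, ℂ)) (ofRealMap (p i) : C(K, ℂ)) * (g i : ℝ)‖ ≤ δ / 3 := fun χ =>
    state_norm_map_sub_sum_le χ hp hp₁ _ fun i x hx => (hg x i).trans (hpε i x hx).le
  have hne : Nonempty t := by
    by_contra h
    rw [not_nonempty_iff] at h
    simpa using sum_map_partition φ hp₁
  obtain ⟨i₀⟩ := hne
  have hsum : ‖∑ i, (φ : WeakDual ℂ C(K, ℂ)) (ofRealMap (p i) : C(K, ℂ)) * (g i : ℝ) -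
      ∑ i, (ψ : WeakDual ℂ C(K, ℂ)) (ofRealMap (p i) : C(K, ℂ)) * (g i : ℝ)‖ ≤ δ / 3 := by
    -- Both families of weights sum to 1, so `g i₀` can be subtracted; the coefficients are then
    -- bounded by the diameter, independently of `g`.
    have e : ∑ i, (φ : WeakDual ℂ C(K, ℂ)) (ofRealMap (p i) : C(K, ℂ)) * ((g i : ℝ) : ℂ) -
        ∑ i, (ψ : WeakDual ℂ C(K, ℂ)) (ofRealMap (p i) : C(K, ℂ)) * ((g i : ℝ) : ℂ) =
        ∑ i, ((φ : WeakDual ℂ C(K, ℂ)) (ofRealMap (p i) : C(K, ℂ)) -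
          (ψ : WeakDual ℂ C(K, ℂ)) (ofRealMap (p i) : C(K, ℂ))) * ((g i : ℂ) - g i₀) := by
      simp only [mul_sub, sub_mul, Finset.sum_sub_distrib, ← Finset.sum_mul,
        sum_map_partition _ hp₁]
      ring
    rw [e]
    refine (norm_sum_le_of_le _ fun i _ => ?_).trans hψ.le
    rw [norm_mul]
    exact mul_le_mul_of_nonneg_left ((hg i i₀).trans (hD _ _)) (norm_nonneg _)
  have h₁ := key φ
  have h₂ := key ψ
  rw [norm_sub_rev] at h₂
  have := (norm_sub_le_norm_sub_add_norm_sub _ _ _).trans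
    (add_le_add h₁ ((norm_sub_le_norm_sub_add_norm_sub _ _ _).trans (add_le_add hsum h₂)))
  linarith

theorem kantorovich_lipSeminorm_lt_top (φ ψ : stateSpace C(K, ℂ)) :
    kantorovich (lipSeminorm K) φ ψ < ∞ := by
  set D : ℝ := Metric.diam (Set.univ : Set K)
  have hD₀ : 0 ≤ D := Metric.diam_nonneg
  refine lt_of_le_of_lt ((kantorovich_le_iff (r := D + D) (by positivity)).2 fun f hf => ?_)
    ENNReal.ofReal_lt_top
  obtain ⟨g, rfl⟩ := ofRealMap_surjective f
  rcases isEmpty_or_nonempty K with hK | ⟨⟨x₀⟩⟩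
  · rw [Subsingleton.elim (ofRealMap g : C(K, ℂ)) 0]
    simpa using hD₀
  have key : ∀ χ : stateSpace C(K, ℂ),
      ‖(χ : WeakDual ℂ C(K, ℂ)) (ofRealMap g : C(K, ℂ)) - g x₀‖ ≤ D := fun χ => by
    -- The trivial partition: a 1-Lipschitz function is within the diameter of its value at `x₀`.
    have := state_norm_map_sub_sum_le χ (ι := Unit) (p := fun _ => 1) (c := fun _ => g x₀) (r := D)
      (fun _ _ => zero_le_one) (by simp) (ofRealMap g) fun _ x _ =>
        (dist_le_of_lipSeminorm_le_one hf x x₀).trans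
          (Metric.dist_le_diam_of_mem isCompact_univ.isBounded (Set.mem_univ x) (Set.mem_univ x₀))
    rwa [Fintype.sum_unique, show (ofRealMap (1 : C(K, ℝ)) : C(K, ℂ)) = 1 by ext; simp, state_map_one χ,
      one_mul] at this
  have h₂ := key ψ
  rw [norm_sub_rev] at h₂
  exact (norm_sub_le_norm_sub_add_norm_sub _ _ _).trans (add_le_add (key φ) h₂)

/-- Convergence for the Monge-Kantorovich metric implies weak* convergence. -/
theorem tendsto_of_tendsto_kantorovich {F : Filter (stateSpace C(K, ℂ))} {φ : stateSpace C(K, ℂ)}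
    (hF : Tendsto (kantorovich (lipSeminorm K) φ) F (𝓝 0)) : Tendsto id F (𝓝 φ) := by
  have hsa : ∀ f : selfAdjoint C(K, ℂ), Tendsto
      (fun ψ : stateSpace C(K, ℂ) => (ψ : WeakDual ℂ C(K, ℂ)) (f : C(K, ℂ))) F
      (𝓝 ((φ : WeakDual ℂ C(K, ℂ)) (f : C(K, ℂ)))) := by
    intro f
    rw [Metric.tendsto_nhds]
    intro ε hε
    obtain ⟨g, hg, hfg⟩ := dense_lipSeminorm_lt_top.exists_dist_lt f (ε := ε / 4) (by positivity)
    -- Adding 1 keeps `c` positive, so that `c⁻¹ • g` lies in the unit ball of the seminorm.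
    obtain ⟨c, hc, hgc⟩ : ∃ c : ℝ, 0 < c ∧ lipSeminorm K g ≤ ENNReal.ofReal c :=
      ⟨(lipSeminorm K g).toReal + 1, by positivity,
        (ENNReal.ofReal_toReal hg.ne).ge.trans (ENNReal.ofReal_le_ofReal (by simp))⟩
    have hclose : ∀ χ : stateSpace C(K, ℂ),
        ‖(χ : WeakDual ℂ C(K, ℂ)) (f : C(K, ℂ)) - (χ : WeakDual ℂ C(K, ℂ)) (g : C(K, ℂ))‖ ≤ ε / 4 := by
      intro χ
      rw [← map_sub, ← AddSubgroupClass.coe_sub]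
      refine state_norm_map_le χ _ fun x => (ContinuousMap.norm_coe_le_norm _ x).trans ?_
      rw [dist_eq_norm] at hfg
      exact hfg.le
    have hev := hF.eventually_lt_const (u := ENNReal.ofReal (ε / 4 / c)) (by simp; positivity)
    filter_upwards [hev] with ψ hψ
    have h := (kantorovich_le_iff (by positivity)).1 hψ.le (c⁻¹ • g) (by
      rw [lipSeminorm_smul]
      refine (mul_le_mul_right hgc _).trans ?_
      rw [← ofReal_norm, ← ENNReal.ofReal_mul (norm_nonneg _), Real.norm_of_nonneg (by positivity),
        inv_mul_cancel₀ hc.ne', ENNReal.ofReal_one])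
    have e : ∀ χ : stateSpace C(K, ℂ), (χ : WeakDual ℂ C(K, ℂ)) ((c⁻¹ • g : selfAdjoint C(K, ℂ)) :
        C(K, ℂ)) = (c⁻¹ : ℝ) * (χ : WeakDual ℂ C(K, ℂ)) (g : C(K, ℂ)) := fun χ => by
      rw [← smul_eq_mul, ← map_smul]
      congr 1
    rw [e, e, ← mul_sub, norm_mul, Complex.norm_real, Real.norm_of_nonneg (by positivity),
      inv_mul_eq_div, div_le_div_iff_of_pos_right hc] at h
    have h₁ := hclose φ
    have h₂ := hclose ψ
    rw [norm_sub_rev] at h₁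
    rw [norm_sub_rev] at h
    rw [dist_eq_norm]
    have := (norm_sub_le_norm_sub_add_norm_sub _ _ _).trans
      (add_le_add h₂ ((norm_sub_le_norm_sub_add_norm_sub _ _ _).trans (add_le_add h h₁)))
    linarith
  -- Weak* convergence is tested on all of `C(K, ℂ)`; real and imaginary parts reduce it to
  -- self-adjoint elements.
  refine tendsto_subtype_rng.2 (tendsto_iff_forall_eval_tendsto_topDualPairing.2 fun f => ?_)
  change Tendsto (fun ψ : stateSpace C(K, ℂ) => (ψ : WeakDual ℂ C(K, ℂ)) f) F
    (𝓝 ((φ : WeakDual ℂ C(K, ℂ)) f))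
  rw [← realPart_add_I_smul_imaginaryPart f]
  simp only [map_add, map_smul]
  exact (hsa _).add ((hsa _).const_smul _)

theorem isLeibnizQCMS_lipSeminorm [Nonempty K] : IsLeibnizQCMS (lipSeminorm K) where
  add_le := lipSeminorm_add_le
  smul_eq := lipSeminorm_smul
  dense_dom := dense_lipSeminorm_lt_top
  eq_zero_iff := lipSeminorm_eq_zero_iff
  kantorovich_lt_top := kantorovich_lipSeminorm_lt_top
  isOpen_iff U := by
    refine ⟨fun hU φ hφ => ?_, fun h => isOpen_iff_mem_nhds.2 fun φ hφ => ?_⟩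
    -- Applied to the filter generated by the Monge-Kantorovich balls around `φ`.
    · have := tendsto_of_tendsto_kantorovich tendsto_comap (hU.mem_nhds hφ)
      exact ((ENNReal.nhds_zero_basis.comap _).mem_iff.1 this).imp fun ε ⟨hε, hεU⟩ => ⟨hε, hεU⟩
    · obtain ⟨ε, hε, hεU⟩ := h φ hφ
      exact (eventually_kantorovich_lt φ hε).mono hεU
  jordan_le f g _ _ := lipSeminorm_jordan_le f g
  lie_le f g _ _ := (lipSeminorm_lie f g).trans_le zero_le
  lowerSemicontinuous := lowerSemicontinuous_lipSeminorm

end States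

/-! ### Tunnels from isometric embeddings, their reach and depth. -/

section Tunnels

variable {K Z : Type u} [MetricSpace K] [CompactSpace K] [MetricSpace Z]

theorem compStarAlgHom'_surjective (j : C(K, Z)) (hj : Isometry j) :
    Function.Surjective (ContinuousMap.compStarAlgHom' ℂ ℂ j) := fun f =>
  ContinuousMap.exists_extension hj.isClosedEmbedding f

variable [CompactSpace Z]

theorem lipSeminorm_comp_le (j : C(K, Z)) (hj : Isometry j) {f : selfAdjoint C(K, ℂ)}
    {g : selfAdjoint C(Z, ℂ)} (h : ContinuousMap.compStarAlgHom' ℂ ℂ j (g : C(Z, ℂ)) = f) :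
    lipSeminorm K f ≤ lipSeminorm Z g := by
  refine (lipSeminorm_le_iff _ _).2 fun x y => ?_
  rw [← h, ← hj.edist_eq x y]
  exact edist_le_lipSeminorm_mul g (j x) (j y)

/-- McShane's extension theorem, in terms of the Lipschitz seminorm. -/
theorem exists_extension_lipSeminorm_le (j : C(K, Z)) (hj : Isometry j) (f : selfAdjoint C(K, ℂ))
    (hf : lipSeminorm K f ≠ ∞) : ∃ g : selfAdjoint C(Z, ℂ),
      ContinuousMap.compStarAlgHom' ℂ ℂ j (g : C(Z, ℂ)) = f ∧
        lipSeminorm Z g ≤ lipSeminorm K f := by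
  rcases isEmpty_or_nonempty K with hK | hK
  · refine ⟨0, Subsingleton.elim _ _, ((lipSeminorm_le_iff _ _).2 fun x y => ?_)⟩
    simp
  lift lipSeminorm K f to NNReal using hf with c hc
  obtain ⟨f, rfl⟩ := ofRealMap_surjective f
  have hinv : ∀ x, Function.invFun j (j x) = x := Function.leftInverse_invFun hj.injective
  -- `invFun j` serves only as the inverse of `j` on its range, where `f` is transported before
  -- being extended.
  have hlip : LipschitzOnWith c (f ∘ Function.invFun j) (Set.range j) := by
    rintro _ ⟨x, rfl⟩ _ ⟨y, rfl⟩
    rw [Function.comp_apply, Function.comp_apply, hinv, hinv, hj.edist_eq]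
    have := (lipSeminorm_le_iff _ _).1 hc.ge x y
    rwa [ofRealMap_apply, ofRealMap_apply, Complex.isometry_ofReal.edist_eq] at this
  obtain ⟨g, hg, hgf⟩ := hlip.extend_real
  refine ⟨ofRealMap ⟨g, hg.continuous⟩, ContinuousMap.ext fun x => ?_,
    (lipSeminorm_le_iff _ _).2 fun x y => ?_⟩
  · have := hgf (Set.mem_range_self x)
    rw [Function.comp_apply, hinv] at this
    exact congrArg Complex.ofReal this.symm
  · rw [ofRealMap_apply, ofRealMap_apply, Complex.isometry_ofReal.edist_eq]
    exact hg x y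

/-- Restriction along an isometry cannot increase the seminorm, and the McShane extension attains
the infimum. -/
theorem lipSeminorm_eq_iInf (j : C(K, Z)) (hj : Isometry j) (f : selfAdjoint C(K, ℂ)) :
    lipSeminorm K f = ⨅ (g : selfAdjoint C(Z, ℂ))
      (_ : ContinuousMap.compStarAlgHom' ℂ ℂ j (g : C(Z, ℂ)) = f), lipSeminorm Z g := by
  refine le_antisymm (le_iInf₂ fun g hg => lipSeminorm_comp_le j hj hg) ?_
  by_cases hf : lipSeminorm K f = ∞
  · simp [hf]
  · obtain ⟨g, hg, hgf⟩ := exists_extension_lipSeminorm_le j hj f hf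
    exact (iInf₂_le g hg).trans hgf

theorem dualMap_combState (j : C(K, Z)) {ι : Type*} [Fintype ι] (w : ι → ℝ) (hw : ∀ i, 0 ≤ w i)
    (hw₁ : ∑ i, w i = 1) (z : ι → K) :
    dualMap (ContinuousMap.compStarAlgHom' ℂ ℂ j) (combState w hw hw₁ z) =
      combState w hw hw₁ (fun i => j (z i)) := by
  refine Subtype.ext (DFunLike.ext _ _ fun f => ?_)
  rw [combState_apply]
  exact combState_apply w hw hw₁ z (f.comp j)

variable {K' : Type u} [MetricSpace K'] [CompactSpace K']

theorem exists_dualMap_kantorovich_le (j : C(K, Z)) (hj : Isometry j) (j' : C(K', Z)) {r ε : ℝ}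
    (hε : 0 < ε) (hr₀ : 0 ≤ r) (hr : ∀ k, ∃ k', dist (j k) (j' k') ≤ r) (φ : stateSpace C(K, ℂ)) :
    ∃ ψ : stateSpace C(K', ℂ),
      kantorovich (lipSeminorm Z) (dualMap (ContinuousMap.compStarAlgHom' ℂ ℂ j) φ)
        (dualMap (ContinuousMap.compStarAlgHom' ℂ ℂ j') ψ) ≤ ENNReal.ofReal (r + ε) := by
  choose y hy using hr
  obtain ⟨t, w, hw, hw₁, h⟩ :=
    exists_combState_kantorovich_le j hj (fun k => j' (y k)) hε hy hr₀ φ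
  refine ⟨combState w hw hw₁ fun i => y i, ?_⟩
  rwa [dualMap_combState]

/-- The Leibniz quantum compact metric space of a nonempty compact metric space. -/
abbrev ofCompact (K : Type u) [MetricSpace K] [CompactSpace K] [Nonempty K] : LeibnizQCMS.{u} :=
  ⟨C(K, ℂ), lipSeminorm K, isLeibnizQCMS_lipSeminorm⟩

variable [Nonempty K] [Nonempty K'] [Nonempty Z]

/-- The tunnel defined by isometric embeddings into a compact metric space. -/
def tunnelOfIsometry (j : C(K, Z)) (hj : Isometry j) (j' : C(K', Z)) (hj' : Isometry j') :
    Tunnel (ofCompact K) (ofCompact K') where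
  mid := ofCompact Z
  left := ContinuousMap.compStarAlgHom' ℂ ℂ j
  right := ContinuousMap.compStarAlgHom' ℂ ℂ j'
  left_surjective := compStarAlgHom'_surjective j hj
  right_surjective := compStarAlgHom'_surjective j' hj'
  left_quotient := lipSeminorm_eq_iInf j hj
  right_quotient := lipSeminorm_eq_iInf j' hj'

theorem reach_tunnelOfIsometry_le (j : C(K, Z)) (hj : Isometry j) (j' : C(K', Z))
    (hj' : Isometry j') :
    (tunnelOfIsometry j hj j' hj').reach ≤
      ENNReal.ofReal (Metric.hausdorffDist (Set.range j) (Set.range j')) := by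
  refine ENNReal.le_of_forall_pos_le_add fun ε hε _ => ?_
  have hfin : Metric.hausdorffEDist (Set.range j) (Set.range j') ≠ ∞ :=
    Metric.hausdorffEDist_ne_top_of_nonempty_of_bounded (Set.range_nonempty _)
      (Set.range_nonempty _) (isCompact_range j.continuous).isBounded
      (isCompact_range j'.continuous).isBounded
  set r := Metric.hausdorffDist (Set.range j) (Set.range j') with hr
  have hr₀ : 0 ≤ r := Metric.hausdorffDist_nonneg
  -- Half of the slack pays for choosing nearby points, as the distance to the other range is only
  -- known to be below any number exceeding `r`; the other half is the mesh of the partition.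
  have hε' : (0 : ℝ) < ε / 2 := by positivity
  have hlt : r < r + ε / 2 := by linarith
  rw [← ENNReal.ofReal_coe_nnreal (p := ε), ← ENNReal.ofReal_add hr₀ ε.coe_nonneg,
    show r + (ε : ℝ) = r + ε / 2 + ε / 2 by ring]
  refine @Metric.hausdorffEDist_le_of_mem_edist (stateSpace C(Z, ℂ))
    (kantorovichEMetric (lipSeminorm Z)) _ _ _ ?_ ?_
  · rintro _ ⟨φ, rfl⟩
    obtain ⟨ψ, hψ⟩ := exists_dualMap_kantorovich_le j hj j' hε' (r := r + ε / 2) (by positivity)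
      (fun k => by
        obtain ⟨_, ⟨k', rfl⟩, h⟩ :=
          Metric.exists_dist_lt_of_hausdorffDist_lt (Set.mem_range_self k) hlt hfin
        exact ⟨k', h.le⟩) φ
    exact ⟨_, ⟨ψ, rfl⟩, hψ⟩
  · rintro _ ⟨φ, rfl⟩
    obtain ⟨ψ, hψ⟩ := exists_dualMap_kantorovich_le j' hj' j hε' (r := r + ε / 2) (by positivity)
      (fun k => by
        obtain ⟨_, ⟨k', rfl⟩, h⟩ :=
          Metric.exists_dist_lt_of_hausdorffDist_lt' (Set.mem_range_self k) hlt hfin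
        exact ⟨k', by rw [dist_comm]; exact h.le⟩) φ
    exact ⟨_, ⟨ψ, rfl⟩, hψ⟩

theorem combState_mem_hullStates (j : C(K, Z)) (hj : Isometry j) (j' : C(K', Z))
    (hj' : Isometry j') (hcover : Set.range j ∪ Set.range j' = Set.univ)
    {ι : Type*} [Fintype ι] (w : ι → ℝ) (hw : ∀ i, 0 ≤ w i) (hw₁ : ∑ i, w i = 1) (z : ι → Z) :
    combState w hw hw₁ z ∈ (tunnelOfIsometry j hj j' hj').hullStates := by
  refine convex_closedConvexHull.sum_mem (fun i _ => hw i) hw₁ fun i _ =>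
    subset_closedConvexHull ?_
  -- Evaluation at `m x` is the pullback of evaluation at `x`, written as a one-term `combState`.
  have heval : ∀ {M : Type u} [MetricSpace M] [CompactSpace M] (m : C(M, Z)) (x : M),
      StrongDual.toWeakDual (ContinuousMap.evalCLM ℂ (m x)) =
        (dualMap (ContinuousMap.compStarAlgHom' ℂ ℂ m) (combState (fun _ : Unit => 1)
          (fun _ => zero_le_one) (by simp) fun _ => x) : WeakDual ℂ C(Z, ℂ)) := by
    intro M _ _ m x
    rw [dualMap_combState]
    refine DFunLike.ext _ _ fun f => ?_
    rw [combState_apply]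
    simp
  rcases hcover.ge (Set.mem_univ (z i)) with ⟨x, hx⟩ | ⟨x, hx⟩ <;> rw [← hx, heval]
  · exact Set.mem_image_of_mem _ (Or.inl (Set.mem_range_self _))
  · exact Set.mem_image_of_mem _ (Or.inr (Set.mem_range_self _))

/-- As the two copies cover `Z`, all convex combinations of evaluations lie in the hull, and they
approximate every state of `C(Z)` arbitrarily well. -/
theorem depth_tunnelOfIsometry (j : C(K, Z)) (hj : Isometry j) (j' : C(K', Z))
    (hj' : Isometry j') (hcover : Set.range j ∪ Set.range j' = Set.univ) :
    (tunnelOfIsometry j hj j' hj').depth = 0 := by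
  refine le_antisymm (ENNReal.le_of_forall_pos_le_add fun ε hε _ => ?_) zero_le
  rw [zero_add]
  refine @Metric.hausdorffEDist_le_of_mem_edist (stateSpace C(Z, ℂ))
    (kantorovichEMetric (lipSeminorm Z)) _ _ _ (fun φ _ => ?_) fun φ _ => ⟨φ, trivial, ?_⟩
  -- With the identity embedding no point moves, so only the mesh `ε` remains.
  · obtain ⟨t, w, hw, hw₁, h⟩ := exists_combState_kantorovich_le (ContinuousMap.id Z) isometry_id id
      (r := 0) (ε := ε) (by exact_mod_cast hε) (fun k => (dist_self k).le) le_rfl φ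
    rw [zero_add, ENNReal.ofReal_coe_nnreal] at h
    exact ⟨_, combState_mem_hullStates j hj j' hj' hcover w hw hw₁ _, h⟩
  · exact ((kantorovichEMetric (lipSeminorm Z)).edist_self φ).trans_le zero_le

theorem dualPropinquity_le_length {A B : LeibnizQCMS.{u}} (τ : Tunnel A B) :
    dualPropinquity A B ≤ τ.length := by
  refine (iInf_le _ ⟨1, ![A, B], rfl, rfl, fun j => match j with | 0 => τ⟩).trans ?_
  simp [Journey.length]

theorem dualPropinquity_ofCompact_le (K K' : Type u) [MetricSpace K] [CompactSpace K] [Nonempty K]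
    [MetricSpace K'] [CompactSpace K'] [Nonempty K'] :
    dualPropinquity (ofCompact K) (ofCompact K') ≤ ENNReal.ofReal (GromovHausdorff.ghDist K K') := by
  have hj := GromovHausdorff.isometry_optimalGHInjl K K'
  have hj' := GromovHausdorff.isometry_optimalGHInjr K K'
  have : Nonempty (GromovHausdorff.OptimalGHCoupling K K') :=
    ‹Nonempty K›.map (GromovHausdorff.optimalGHInjl K K')
  refine (dualPropinquity_le_length
    (tunnelOfIsometry ⟨_, hj.continuous⟩ hj ⟨_, hj'.continuous⟩ hj')).trans (max_le ?_ ?_)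
  · rw [← GromovHausdorff.hausdorffDist_optimal]
    exact reach_tunnelOfIsometry_le _ _ _ _
  · rw [depth_tunnelOfIsometry]
    · exact zero_le
    · refine Set.eq_univ_of_forall fun z => ?_
      -- The optimal coupling is a quotient of the disjoint union `K ⊕ K'`, hence covered by the two
      -- copies.
      obtain ⟨x | y, rfl⟩ := Quot.exists_rep z
      · exact Or.inl ⟨x, rfl⟩
      · exact Or.inr ⟨y, rfl⟩

end Tunnels

end DualPropinquity

end

theorem mainTheorem6 (X Y : Type u) [MetricSpace X] [CompactSpace X] [Nonempty X]
    [MetricSpace Y] [CompactSpace Y] [Nonempty Y] :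
    ∃ (hX : DualPropinquity.IsLeibnizQCMS (DualPropinquity.lipSeminorm X))
      (hY : DualPropinquity.IsLeibnizQCMS (DualPropinquity.lipSeminorm Y)),
      DualPropinquity.dualPropinquity
          ⟨C(X, ℂ), DualPropinquity.lipSeminorm X, hX⟩
          ⟨C(Y, ℂ), DualPropinquity.lipSeminorm Y, hY⟩ ≤
        ENNReal.ofReal (GromovHausdorff.ghDist X Y) :=
  ⟨DualPropinquity.isLeibnizQCMS_lipSeminorm, DualPropinquity.isLeibnizQCMS_lipSeminorm,
    DualPropinquity.dualPropinquity_ofCompact_le X Y⟩
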